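/- Let $R$ be a commutative local ring, that is, a commutative ring with exactly one maximal ideal $P$ (not necessarily noetherian), and let $J=\bigcap_{n\in\mathbb{N}}P^n$. An exact sequence of $R$-modules $0\to N\to M\to L\to 0$ is RD-exact if, identifying $N$ with its image in $M$, $rM\cap N=rN$ for every $r\in R$. An $R$-module $F$ is RD-injective if for every RD-exact sequence $0\to N\to M\to L\to 0$ the sequence $0\to \mathrm{Hom}_R(L,F)\to \mathrm{Hom}_R(M,F)\to \mathrm{Hom}_R(N,F)\to 0$ is exact; it is RD-flat if for every such sequence $0\to F\otimes_R N\to F\otimes_R M\to F\otimes_R L\to 0$ is exact. Let $L(P)$ be the sum of all submodules of finite length of the injective hull $\mathrm{E}(R/P)$. For a proper ideal $A$ of $R$ let $A^*$ be the set of non-zero principal ideals of $R$ contained in $A$. A family $\mathcal F$ of ideals is directed if for all $U,V\in\mathcal F$ there is $W\in\mathcal F$ with $U+V\subseteq W$ (so the empty family is directed). Then the following conditions are equivalent: 1. Every artinian $R$-module is RD-injective. 2. $R/P$ and $R/J$ are RD-flat. 3. $R/P$ and $L(P)$ are RD-injective. 4. $P^*$ and $J^*$ are directed. -/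

import Mathlib

open scoped Pointwise

universe u

/-- A submodule `F` of an `R`-module `E` is an RD-submodule (relatively divisible)
if `rE ∩ F = rF` for every `r ∈ R`. -/
def IsRDSubmodule {R : Type u} [CommRing R] {E : Type u} [AddCommGroup E] [Module R E]
    (F : Submodule R E) : Prop :=
  ∀ r : R, (r • (⊤ : Submodule R E)) ⊓ F = r • F

/-- The sequence `0 → N → M → L → 0` given by `f` and `g` is exact. -/
def IsShortExact {R : Type u} [CommRing R] {N M L : Type u}
    [AddCommGroup N] [Module R N] [AddCommGroup M] [Module R M] [AddCommGroup L] [Module R L]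
    (f : N →ₗ[R] M) (g : M →ₗ[R] L) : Prop :=
  Function.Injective f ∧ Function.Exact f g ∧ Function.Surjective g

/-- The sequence `0 → N → M → L → 0` given by `f` and `g` is RD-exact: it is exact and
the image of `N` is an RD-submodule of `M`. -/
def IsRDExact {R : Type u} [CommRing R] {N M L : Type u}
    [AddCommGroup N] [Module R N] [AddCommGroup M] [Module R M] [AddCommGroup L] [Module R L]
    (f : N →ₗ[R] M) (g : M →ₗ[R] L) : Prop :=
  IsShortExact f g ∧ IsRDSubmodule (LinearMap.range f)

/-- `F` is RD-injective: for every RD-exact sequence `0 → N → M → L → 0`, the sequence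
`0 → Hom(L, F) → Hom(M, F) → Hom(N, F) → 0` is exact. -/
def IsRDInjective (R : Type u) [CommRing R] (F : Type u) [AddCommGroup F] [Module R F] : Prop :=
  ∀ ⦃N M L : Type u⦄ [AddCommGroup N] [Module R N] [AddCommGroup M] [Module R M]
    [AddCommGroup L] [Module R L] (f : N →ₗ[R] M) (g : M →ₗ[R] L),
    IsRDExact f g → IsShortExact (LinearMap.lcomp R F g) (LinearMap.lcomp R F f)

/-- `F` is RD-flat: for every RD-exact sequence `0 → N → M → L → 0`, the sequence
`0 → F ⊗ N → F ⊗ M → F ⊗ L → 0` is exact. -/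
def IsRDFlat (R : Type u) [CommRing R] (F : Type u) [AddCommGroup F] [Module R F] : Prop :=
  ∀ ⦃N M L : Type u⦄ [AddCommGroup N] [Module R N] [AddCommGroup M] [Module R M]
    [AddCommGroup L] [Module R L] (f : N →ₗ[R] M) (g : M →ₗ[R] L),
    IsRDExact f g → IsShortExact (LinearMap.lTensor F f) (LinearMap.lTensor F g)

/-- A family of submodules is directed if the sum of any two members is contained in a member.
(The empty family is directed.) -/
def IsDirectedFamily {R : Type u} [CommRing R] {M : Type u} [AddCommGroup M] [Module R M]
    (𝓕 : Set (Submodule R M)) : Prop :=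
  ∀ U ∈ 𝓕, ∀ V ∈ 𝓕, ∃ W ∈ 𝓕, U ⊔ V ≤ W

/-- `A*`: the set of nonzero principal ideals contained in the ideal `A`. -/
def nonzeroPrincipalIdealsIn {R : Type u} [CommRing R] (A : Ideal R) : Set (Ideal R) :=
  {I | I ≠ ⊥ ∧ I ≤ A ∧ ∃ r : R, I = Ideal.span {r}}

/-- `i : M → E` is an injective hull of `M`: `E` is injective, and `i` is an essential
monomorphism. -/
def IsInjectiveHull {R : Type u} [CommRing R] {M E : Type u} [AddCommGroup M] [Module R M]
    [AddCommGroup E] [Module R E] (i : M →ₗ[R] E) : Prop :=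
  Module.Injective R E ∧ Function.Injective i ∧
    ∀ K : Submodule R E, K ⊓ LinearMap.range i = ⊥ → K = ⊥

/-- In an injective module, every submodule has an essential extension that is injective. -/
theorem exists_injective_essential {R : Type u} [CommRing R] {I : Type u} [AddCommGroup I]
    [Module R I] (hI : Module.Injective R I) (S : Submodule R I) :
    ∃ N : Submodule R I, S ≤ N ∧ (∀ K ≤ N, K ⊓ S = ⊥ → K = ⊥) ∧ Module.Injective R N := by
  obtain ⟨N, hSN, hNmax⟩ := zorn_le_nonempty₀
    {N : Submodule R I | S ≤ N ∧ ∀ K ≤ N, K ⊓ S = ⊥ → K = ⊥} (by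
      intro c hc hchain y hy
      refine ⟨sSup c, ⟨(hc hy).1.trans (le_sSup hy), ?_⟩, fun z hz => le_sSup hz⟩
      intro K hK hKS
      rw [Submodule.eq_bot_iff]
      intro x hx
      obtain ⟨N, hN, hxN⟩ := (Submodule.mem_sSup_of_directed ⟨y, hy⟩ hchain.directedOn).1 (hK hx)
      have h := (hc hN).2 (K ⊓ N) inf_le_right
        (le_bot_iff.1 (le_trans (inf_le_inf_right S inf_le_left) hKS.le))
      exact (Submodule.eq_bot_iff _).1 h x ⟨hx, hxN⟩) S ⟨le_rfl, fun K hK h => by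
        rwa [inf_eq_left.2 hK] at h⟩
  have hN := hNmax.prop
  obtain ⟨C, -, hCmax⟩ := zorn_le_nonempty₀ {C : Submodule R I | C ⊓ N = ⊥} (by
      intro c hc hchain y hy
      refine ⟨sSup c, ?_, fun z hz => le_sSup hz⟩
      change sSup c ⊓ N = ⊥
      rw [Submodule.eq_bot_iff]
      rintro x ⟨hx, hxN⟩
      obtain ⟨D, hD, hxD⟩ := (Submodule.mem_sSup_of_directed ⟨y, hy⟩ hchain.directedOn).1 hx
      exact (Submodule.eq_bot_iff _).1 (hc hD) x ⟨hxD, hxN⟩) ⊥ (bot_inf_eq N)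
  have hC : C ⊓ N = ⊥ := hCmax.prop
  have hqinj : Function.Injective (C.mkQ ∘ₗ N.subtype) := by
    rw [← LinearMap.ker_eq_bot, Submodule.eq_bot_iff]
    intro x hx
    have hx' : (x : I) ∈ C := by simpa using hx
    exact Subtype.ext ((Submodule.eq_bot_iff _).1 hC x ⟨hx', x.2⟩)
  obtain ⟨h, hh⟩ := hI.out _ hqinj N.subtype
  let p : I →ₗ[R] I := h ∘ₗ C.mkQ
  have hp : ∀ n ∈ N, p n = n := fun n hn => hh ⟨n, hn⟩
  have hCker : C ≤ LinearMap.ker p := fun x hx => by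
    have : C.mkQ x = 0 := by simpa using hx
    simp [p, this]
  have hcomap : ∀ K : Submodule R I, K ⊓ N = ⊥ → K.comap p ≤ C := by
    intro K hK
    refine hCmax.le_of_ge (y := K.comap p) ?_ (fun x hx => ?_)
    · change K.comap p ⊓ N = ⊥
      rw [Submodule.eq_bot_iff]
      rintro x ⟨hx, hxN⟩
      refine (Submodule.eq_bot_iff _).1 hK x ⟨?_, hxN⟩
      have : p x ∈ K := hx
      rwa [hp x hxN] at this
    · have : p x = 0 := hCker hx
      change p x ∈ K
      rw [this]
      exact K.zero_mem
  have hNr : N ≤ LinearMap.range p := fun n hn => ⟨n, hp n hn⟩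
  have hr : LinearMap.range p ≤ N := by
    refine hNmax.le_of_ge ⟨hN.1.trans hNr, ?_⟩ hNr
    intro K hK hKS
    have hKN : K ⊓ N = ⊥ := hN.2 _ inf_le_right
      (le_bot_iff.1 (le_trans (inf_le_inf_right S inf_le_left) hKS.le))
    rw [Submodule.eq_bot_iff]
    intro x hx
    obtain ⟨y, rfl⟩ := hK hx
    exact hCker (hcomap K hKN hx)
  refine ⟨N, hN.1, hN.2, ⟨fun X Y _ _ _ _ f hf g => ?_⟩⟩
  obtain ⟨k, hk⟩ := hI.out f hf (N.subtype ∘ₗ g)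
  refine ⟨(p.codRestrict N fun x => hr ⟨x, rfl⟩) ∘ₗ k, fun x => Subtype.ext ?_⟩
  have := hk x
  simp only [LinearMap.comp_apply, Submodule.subtype_apply] at this
  simp [this, hp _ (g x).2]

/-- Every module has an injective hull. -/
theorem exists_isInjectiveHull (R : Type u) [CommRing R] (M : Type u) [AddCommGroup M]
    [Module R M] : ∃ (E : ModuleCat.{u} R) (i : M →ₗ[R] E), IsInjectiveHull i := by
  obtain ⟨⟨J, hJ, f, hf⟩⟩ := CategoryTheory.EnoughInjectives.presentation (ModuleCat.of R M)
  have hJ' : Module.Injective R J := Module.injective_module_of_injective_object R J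
  have hf' : Function.Injective f.hom := (ModuleCat.mono_iff_injective f).1 hf
  obtain ⟨N, hSN, hess, hN⟩ := exists_injective_essential hJ' (LinearMap.range f.hom)
  refine ⟨ModuleCat.of R N, f.hom.codRestrict N fun x => hSN ⟨x, rfl⟩, hN, ?_, ?_⟩
  · intro x y hxy
    exact hf' (congrArg Subtype.val hxy)
  · intro K hK
    have h : K.map N.subtype = ⊥ := by
      refine hess _ (Submodule.map_subtype_le N K) ?_
      rw [Submodule.eq_bot_iff]
      rintro x ⟨⟨k, hk, rfl⟩, m, hm⟩
      have : k = 0 := (Submodule.eq_bot_iff _).1 hK k ⟨hk, m, Subtype.ext hm⟩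
      simp [this]
    exact Submodule.map_injective_of_injective N.injective_subtype (h.trans (Submodule.map_bot _).symm)

/-- The injective hull `E(M)` of the `R`-module `M`. -/
noncomputable def injectiveHull (R : Type u) [CommRing R] (M : Type u) [AddCommGroup M]
    [Module R M] : ModuleCat.{u} R :=
  (exists_isInjectiveHull R M).choose

/-- The canonical embedding `M → E(M)`. -/
noncomputable def injectiveHull.ι (R : Type u) [CommRing R] (M : Type u) [AddCommGroup M]
    [Module R M] : M →ₗ[R] injectiveHull R M :=
  (exists_isInjectiveHull R M).choose_spec.choose

theorem injectiveHull.isInjectiveHull (R : Type u) [CommRing R] (M : Type u) [AddCommGroup M]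
    [Module R M] : IsInjectiveHull (injectiveHull.ι R M) :=
  (exists_isInjectiveHull R M).choose_spec.choose_spec

/-- `L(P)`: the sum of all submodules of finite length of `E(R/P)`. -/
noncomputable def sumFiniteLength (R : Type u) [CommRing R] (P : Ideal R) :
    Submodule R (injectiveHull R (R ⧸ P)) :=
  sSup {N | IsFiniteLength R N}

/-! ### RD-submodules, RD-flat cyclic modules and common divisors. -/

section RD

variable {R : Type u} [CommRing R]

/-! Everything is measured against RD-flatness of `R ⧸ A`, which says that `A M ∩ N = A N` for each
RD-submodule `N ≤ M`. For `R` local and `A` proper this means that any two elements of `A` have a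
common divisor in `A` (`isRDFlat_quotient_iff_directed`). Given common divisors, each element of `A
M` is a single multiple `c m` with `c ∈ A`, and relative divisibility moves `m` into `N`. For the
converse a universal RD-extension is tested, in which `a x + b y` lies in `N`. This gives 2 ⇔ 4.

For 2 ⇔ 3 let `E = E(R/P)` and let `E[A]` be the annihilator of `A` in `E`. Since `E` is an
injective cogenerator, `E[A]` is RD-injective exactly when `R ⧸ A` is RD-flat. Moreover `R/P ≅
E[P]`, and `L(P) = E[J]` once `P*` is directed.

If `P*` is directed, then `P = (p)` or `P = J` (`maximalIdeal_eq_span_or_iInf_pow_eq`). Artinian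
modules are killed by `J`, so for `P = J` they are vector spaces over `R/P`. For `P = (p)` an
artinian `M` splits as `D ⊕ C` with `D = p ^ n M` divisible, hence injective over `R/J`, and `p ^ n
C = 0`; RD-submodules of modules killed by `p ^ n` are summands, so `C` is RD-injective too. This
gives 2 ⇒ 1. Finally 1 ⇒ 3 holds because `R/P` and `E[J]` are artinian. -/

theorem isRDSubmodule_iff {M : Type u} [AddCommGroup M] [Module R M] {N : Submodule R M} :
    IsRDSubmodule N ↔ ∀ (r : R) (m : M), r • m ∈ N → ∃ n ∈ N, r • n = r • m := by
  constructor
  · intro h r m hm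
    have : r • m ∈ r • N :=
      h r ▸ ⟨Submodule.smul_mem_pointwise_smul m r ⊤ trivial, hm⟩
    exact (Submodule.mem_smul_pointwise_iff_exists _ _ _).1 this
  · intro h r
    ext x
    simp only [Submodule.mem_inf, Submodule.mem_smul_pointwise_iff_exists]
    constructor
    · rintro ⟨⟨m, -, rfl⟩, hx⟩
      exact h r m hx
    · rintro ⟨n, hn, rfl⟩
      exact ⟨⟨n, trivial, rfl⟩, N.smul_mem r hn⟩

theorem isRDExact_subtype_mkQ {M : Type u} [AddCommGroup M] [Module R M] {N : Submodule R M}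
    (hN : IsRDSubmodule N) : IsRDExact N.subtype N.mkQ :=
  ⟨⟨N.injective_subtype, LinearMap.exact_subtype_mkQ N, N.mkQ_surjective⟩, by
    rwa [Submodule.range_subtype]⟩

theorem isRDInjective_iff {F : Type u} [AddCommGroup F] [Module R F] :
    IsRDInjective R F ↔ ∀ ⦃M : Type u⦄ [AddCommGroup M] [Module R M] (N : Submodule R M),
      IsRDSubmodule N → ∀ φ : N →ₗ[R] F, ∃ ψ : M →ₗ[R] F, ∀ n : N, ψ n = φ n := by
  constructor
  · intro h M _ _ N hN φ
    obtain ⟨ψ, hψ⟩ := (h _ _ (isRDExact_subtype_mkQ hN)).2.2 φ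
    exact ⟨ψ, fun n => LinearMap.congr_fun hψ n⟩
  · intro h N M L _ _ _ _ _ _ f g hfg
    refine ⟨LinearMap.lcomp_injective_of_surjective g hfg.1.2.2,
      LinearMap.exact_lcomp_of_exact_of_surjective F hfg.1.2.1 hfg.1.2.2, fun φ => ?_⟩
    let e := LinearEquiv.ofInjective f hfg.1.1
    obtain ⟨ψ, hψ⟩ := h _ hfg.2 (φ ∘ₗ e.symm.toLinearMap)
    refine ⟨ψ, LinearMap.ext fun n => ?_⟩
    have := hψ (e n)
    simpa [e] using this

theorem IsRDInjective.of_linearEquiv {F G : Type u} [AddCommGroup F] [Module R F]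
    [AddCommGroup G] [Module R G] (e : F ≃ₗ[R] G) (hF : IsRDInjective R F) :
    IsRDInjective R G := by
  rw [isRDInjective_iff] at hF ⊢
  intro M _ _ N hN φ
  obtain ⟨ψ, hψ⟩ := hF N hN (e.symm.toLinearMap ∘ₗ φ)
  exact ⟨e.toLinearMap ∘ₗ ψ, fun n => by simp [hψ]⟩

/-- Here `M = D ⊕ ker e`, and maps extend one component at a time. -/
theorem IsRDInjective.of_retract {M : Type u} [AddCommGroup M] [Module R M] {D : Submodule R M}
    (e : M →ₗ[R] D) (he : ∀ d : D, e d = d) (hD : IsRDInjective R D)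
    (hC : IsRDInjective R (LinearMap.ker e)) : IsRDInjective R M := by
  rw [isRDInjective_iff] at *
  intro X _ _ N hN φ
  obtain ⟨α, hα⟩ := hD N hN (e ∘ₗ φ)
  let q : M →ₗ[R] LinearMap.ker e :=
    (LinearMap.id - D.subtype ∘ₗ e).codRestrict _ fun x => by simp [he]
  have hq : ∀ x, (q x : M) = x - e x := fun x => rfl
  obtain ⟨β, hβ⟩ := hC N hN (q ∘ₗ φ)
  refine ⟨D.subtype ∘ₗ α + (LinearMap.ker e).subtype ∘ₗ β, fun n => ?_⟩
  simp [hα, hβ, hq]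

/-- `R ⧸ A` is RD-flat iff `A M ∩ N = A N` for each RD-submodule `N` of a module `M`. -/
theorem isRDFlat_quotient_iff (A : Ideal R) :
    IsRDFlat R (R ⧸ A) ↔ ∀ ⦃M : Type u⦄ [AddCommGroup M] [Module R M] (N : Submodule R M),
      IsRDSubmodule N → (A • (⊤ : Submodule R M)) ⊓ N ≤ A • N := by
  constructor
  · rintro h M _ _ N hN x ⟨hx, hxN⟩
    have hinj := (h _ _ (isRDExact_subtype_mkQ hN)).1
    have h1 : LinearMap.lTensor (R ⧸ A) N.subtype
        (Ideal.Quotient.mk A 1 ⊗ₜ[R] (⟨x, hxN⟩ : N)) = 0 := by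
      apply (TensorProduct.quotTensorEquivQuotSMul M A).injective
      rw [LinearMap.lTensor_tmul, TensorProduct.quotTensorEquivQuotSMul_mk_tmul]
      simpa using hx
    have h2 := hinj (h1.trans (map_zero _).symm)
    have h3 := congrArg (TensorProduct.quotTensorEquivQuotSMul N A) h2
    rw [TensorProduct.quotTensorEquivQuotSMul_mk_tmul, one_smul, map_zero,
      Submodule.Quotient.mk_eq_zero] at h3
    have := Submodule.mem_map_of_mem (f := N.subtype) h3
    rwa [Submodule.map_smul'', Submodule.map_top, Submodule.range_subtype] at this
  · intro h N M L _ _ _ _ _ _ f g hfg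
    refine ⟨?_, lTensor_exact _ hfg.1.2.1 hfg.1.2.2, LinearMap.lTensor_surjective _ hfg.1.2.2⟩
    rw [← LinearMap.ker_eq_bot, Submodule.eq_bot_iff]
    intro z hz
    obtain ⟨n, hn⟩ := Submodule.mkQ_surjective _ (TensorProduct.quotTensorEquivQuotSMul N A z)
    obtain rfl : z = Ideal.Quotient.mk A 1 ⊗ₜ[R] n := by
      apply (TensorProduct.quotTensorEquivQuotSMul N A).injective
      rw [TensorProduct.quotTensorEquivQuotSMul_mk_tmul, one_smul, ← hn, Submodule.mkQ_apply]
    rw [LinearMap.mem_ker, LinearMap.lTensor_tmul] at hz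
    have h3 := congrArg (TensorProduct.quotTensorEquivQuotSMul M A) hz
    rw [TensorProduct.quotTensorEquivQuotSMul_mk_tmul, one_smul, map_zero,
      Submodule.Quotient.mk_eq_zero] at h3
    have h4 := h _ hfg.2 ⟨h3, n, rfl⟩
    rw [LinearMap.range_eq_map, ← Submodule.map_smul''] at h4
    obtain ⟨n', hn', he⟩ := h4
    rw [hfg.1.1 he] at hn'
    apply (TensorProduct.quotTensorEquivQuotSMul N A).injective
    rw [TensorProduct.quotTensorEquivQuotSMul_mk_tmul, one_smul, map_zero,
      Submodule.Quotient.mk_eq_zero]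
    exact hn'

theorem isDirectedFamily_nonzeroPrincipalIdealsIn_iff (A : Ideal R) :
    IsDirectedFamily (nonzeroPrincipalIdealsIn A) ↔
      ∀ a ∈ A, ∀ b ∈ A, ∃ c ∈ A, c ∣ a ∧ c ∣ b := by
  constructor
  · intro h a ha b hb
    by_cases ha0 : a = 0
    · exact ⟨b, hb, ha0 ▸ dvd_zero b, dvd_rfl⟩
    by_cases hb0 : b = 0
    · exact ⟨a, ha, dvd_rfl, hb0 ▸ dvd_zero a⟩
    obtain ⟨W, ⟨-, hWA, c, rfl⟩, hW⟩ := h (Ideal.span {a})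
      ⟨by simpa using ha0, by simpa [Ideal.span_le] using ha, a, rfl⟩ (Ideal.span {b})
      ⟨by simpa using hb0, by simpa [Ideal.span_le] using hb, b, rfl⟩
    refine ⟨c, hWA (Ideal.mem_span_singleton_self c), ?_, ?_⟩
    · exact Ideal.mem_span_singleton.1 (hW (Ideal.mem_sup_left (Ideal.mem_span_singleton_self a)))
    · exact Ideal.mem_span_singleton.1 (hW (Ideal.mem_sup_right (Ideal.mem_span_singleton_self b)))
  · rintro h U ⟨hU0, hU, a, rfl⟩ V ⟨-, hV, b, rfl⟩
    obtain ⟨c, hc, hca, hcb⟩ := h a (hU (Ideal.mem_span_singleton_self a)) b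
      (hV (Ideal.mem_span_singleton_self b))
    have hle : Ideal.span {a} ⊔ Ideal.span {b} ≤ Ideal.span {c} :=
      sup_le (Ideal.span_singleton_le_span_singleton.2 hca)
        (Ideal.span_singleton_le_span_singleton.2 hcb)
    -- The ideal `(c)` is nonzero because it contains the nonzero member `(a)`.
    refine ⟨Ideal.span {c}, ⟨fun h0 => hU0 ?_, by simpa [Ideal.span_le] using hc, c, rfl⟩, hle⟩
    exact le_bot_iff.1 ((le_sup_left.trans hle).trans h0.le)

theorem exists_dvd_of_directed {A : Ideal R} (h : ∀ a ∈ A, ∀ b ∈ A, ∃ c ∈ A, c ∣ a ∧ c ∣ b)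
    {M : Type u} [AddCommGroup M] [Module R M] {x : M} (hx : x ∈ A • (⊤ : Submodule R M)) :
    ∃ c ∈ A, ∃ m : M, x = c • m := by
  induction hx using Submodule.smul_induction_on' with
  | smul a ha m _ => exact ⟨a, ha, m, rfl⟩
  | add x _ y _ hx hy =>
    obtain ⟨a, ha, m, rfl⟩ := hx
    obtain ⟨b, hb, m', rfl⟩ := hy
    obtain ⟨c, hc, ⟨s, rfl⟩, t, rfl⟩ := h a ha b hb
    exact ⟨c, hc, s • m + t • m', by simp [mul_smul]⟩

theorem isRDFlat_quotient_of_directed {A : Ideal R}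
    (h : ∀ a ∈ A, ∀ b ∈ A, ∃ c ∈ A, c ∣ a ∧ c ∣ b) : IsRDFlat R (R ⧸ A) := by
  rw [isRDFlat_quotient_iff]
  rintro M _ _ N hN x ⟨hx, hxN⟩
  obtain ⟨c, hc, m, rfl⟩ := exists_dvd_of_directed h hx
  obtain ⟨n, hn, he⟩ := isRDSubmodule_iff.1 hN c m hxN
  exact he ▸ Submodule.smul_mem_smul hc hn

/-! ### The universal module testing RD-flatness of `R ⧸ A`. -/

section Presentation

variable (a b : R)

/-- Pairs `(r, s)` such that `r` divides both `s a` and `s b`. -/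
abbrev CommonDivisorPair : Type u := {q : R × R // q.1 ∣ q.2 * a ∧ q.1 ∣ q.2 * b}

/-- The relations `s n = r z` indexed by the pairs `q = (r, s)`, where `n` is the generator
of the first factor and `z` the generator with index `q`. -/
noncomputable def divisionRelation :
    (CommonDivisorPair a b →₀ R) →ₗ[R] R × (CommonDivisorPair a b →₀ R) :=
  Finsupp.lsum R fun q => LinearMap.toSpanSingleton R _ (q.1.2, -Finsupp.single q q.1.1)

/-- The module generated by an element `n` and by elements `z` with `s n = r z`, one for each
pair `(r, s)` such that `r` divides both `s a` and `s b`. -/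
abbrev DivisionModule : Type u :=
  (R × (CommonDivisorPair a b →₀ R)) ⧸ LinearMap.range (divisionRelation a b)

/-- The generator `n` of the division module. -/
noncomputable def DivisionModule.gen : DivisionModule a b :=
  Submodule.Quotient.mk (1, 0)

variable {a b}

theorem DivisionModule.exists_smul_eq {r s : R} (ha : r ∣ s * a) (hb : r ∣ s * b) :
    ∃ z : DivisionModule a b, s • gen a b = r • z := by
  let q : CommonDivisorPair a b := ⟨(r, s), ha, hb⟩
  refine ⟨Submodule.Quotient.mk (0, Finsupp.single q 1), ?_⟩
  rw [gen, ← Submodule.Quotient.mk_smul, ← Submodule.Quotient.mk_smul, Submodule.Quotient.eq]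
  refine ⟨Finsupp.single q 1, ?_⟩
  simp [divisionRelation, q]

theorem divisionRelation_fst (t : CommonDivisorPair a b →₀ R) :
    (divisionRelation a b t).1 = ∑ q ∈ t.support, t q * q.1.2 := by
  simp [divisionRelation, Finsupp.sum, Prod.fst_sum]

theorem divisionRelation_snd (t : CommonDivisorPair a b →₀ R) (q : CommonDivisorPair a b) :
    (divisionRelation a b t).2 q = -(t q * q.1.1) := by
  induction t using Finsupp.induction_linear with
  | zero => simp
  | add f g hf hg => simp [hf, hg, add_mul, add_comm]
  | single p c =>
    rcases eq_or_ne p q with rfl | h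
    · simp [divisionRelation]
    · simp [divisionRelation, h]

theorem apply_mem_of_mem_smul_top {X : Type u} [AddCommGroup X] [Module R X] (f : X →ₗ[R] R)
    {A : Ideal R} {x : X} (hx : x ∈ A • (⊤ : Submodule R X)) : f x ∈ A := by
  refine Submodule.smul_induction_on hx (fun a ha x _ => ?_) (fun x y hx hy => ?_)
  · rw [map_smul, smul_eq_mul]
    exact A.mul_mem_right _ ha
  · rw [map_add]
    exact add_mem hx hy

theorem ideal_smul_range {X Y : Type u} [AddCommGroup X] [Module R X] [AddCommGroup Y]
    [Module R Y] (A : Ideal R) (f : X →ₗ[R] Y) :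
    A • LinearMap.range f = (A • (⊤ : Submodule R X)).map f := by
  rw [Submodule.map_smul'', Submodule.map_top]

/-- Some representative of the generator has all coordinates in `A`; it differs from `(1, 0)` by the
relation with coefficients `t`, and the conclusion is read off coordinate by coordinate. -/
theorem DivisionModule.gen_mem_smul_top {A : Ideal R}
    (h : gen a b ∈ A • (⊤ : Submodule R (DivisionModule a b))) :
    ∃ t : CommonDivisorPair a b →₀ R,
      1 - ∑ q ∈ t.support, t q * q.1.2 ∈ A ∧ ∀ q, t q * q.1.1 ∈ A := by
  rw [← Submodule.range_mkQ (LinearMap.range (divisionRelation a b)), ideal_smul_range] at h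
  obtain ⟨y, hy, he⟩ := h
  obtain ⟨t, ht⟩ := (Submodule.Quotient.eq (LinearMap.range (divisionRelation a b))
    (x := (1, 0)) (y := y)).1 he.symm
  refine ⟨t, ?_, fun q => ?_⟩
  · have := apply_mem_of_mem_smul_top (LinearMap.fst R R _) hy
    rw [← divisionRelation_fst, ht]
    simpa using this
  · have := apply_mem_of_mem_smul_top (Finsupp.lapply q ∘ₗ LinearMap.snd R R _) hy
    have h2 := divisionRelation_snd t q
    rw [ht] at h2
    simpa [← neg_eq_iff_eq_neg.2 h2] using this

end Presentation

/-- Two generators `x`, `y` are adjoined to the division module `N`, with `n = a x + b y`. The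
relations of `N` are just those that make it relatively divisible in the extension, so RD-flatness
puts `n` in `A N`. -/
theorem exists_dvd_of_isRDFlat_quotient [IsLocalRing R] {A : Ideal R} (hA : A ≠ ⊤)
    (h : IsRDFlat R (R ⧸ A)) {a b : R} (ha : a ∈ A) (hb : b ∈ A) : ∃ c ∈ A, c ∣ a ∧ c ∣ b := by
  rw [isRDFlat_quotient_iff] at h
  let K : Submodule R (DivisionModule a b × R × R) :=
    Submodule.span R {(DivisionModule.gen a b, -a, -b)}
  let f : DivisionModule a b →ₗ[R] (DivisionModule a b × R × R) ⧸ K :=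
    K.mkQ ∘ₗ LinearMap.inl R _ _
  have hf : ∀ x, f x = Submodule.Quotient.mk (x, 0, 0) := fun x => rfl
  have hinj : Function.Injective f := by
    rw [← LinearMap.ker_eq_bot, Submodule.eq_bot_iff]
    intro x hx
    rw [LinearMap.mem_ker, hf, Submodule.Quotient.mk_eq_zero, Submodule.mem_span_singleton] at hx
    obtain ⟨s, hs⟩ := hx
    simp only [Prod.smul_mk, Prod.mk.injEq, smul_eq_mul, mul_neg, neg_eq_zero] at hs
    -- If `s` kills `a` and `b`, the pair `(0, s)` is admissible, and its relation reads `s n = 0`.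
    obtain ⟨z, hz⟩ := DivisionModule.exists_smul_eq (a := a) (b := b) (r := 0) (s := s)
      (by simp [hs]) (by simp [hs])
    rw [← hs.1, hz, zero_smul]
  have hRD : IsRDSubmodule (LinearMap.range f) := by
    rw [isRDSubmodule_iff]
    rintro r m ⟨x, hx⟩
    obtain ⟨⟨y, c, d⟩, rfl⟩ := Submodule.mkQ_surjective _ m
    rw [hf, Submodule.mkQ_apply, ← Submodule.Quotient.mk_smul, Submodule.Quotient.eq,
      Submodule.mem_span_singleton] at hx
    obtain ⟨s, hs⟩ := hx
    simp only [Prod.smul_mk, Prod.mk_sub_mk, Prod.mk.injEq, smul_eq_mul, mul_neg, zero_sub,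
      neg_inj] at hs
    -- Now `x = r y + s n` with `s a = r c` and `s b = r d`, so `s n` is divisible by `r` inside
    -- `N`.
    obtain ⟨z, hz⟩ := DivisionModule.exists_smul_eq (a := a) (b := b) (r := r) (s := s)
      ⟨c, hs.2.1⟩ ⟨d, hs.2.2⟩
    refine ⟨f (y + z), ⟨_, rfl⟩, ?_⟩
    rw [← map_smul, smul_add, ← hz, hs.1, add_sub_cancel, hf, Submodule.mkQ_apply,
      ← Submodule.Quotient.mk_smul, Submodule.Quotient.eq, Submodule.mem_span_singleton]
    refine ⟨s, ?_⟩
    simp [hs]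
  have hgen : f (DivisionModule.gen a b) ∈
      A • (⊤ : Submodule R ((DivisionModule a b × R × R) ⧸ K)) := by
    have : f (DivisionModule.gen a b) = a • Submodule.Quotient.mk (p := K) (0, 1, 0) +
        b • Submodule.Quotient.mk (p := K) (0, 0, 1) := by
      rw [hf, ← Submodule.Quotient.mk_smul, ← Submodule.Quotient.mk_smul,
        ← Submodule.Quotient.mk_add, Submodule.Quotient.eq, Submodule.mem_span_singleton]
      exact ⟨1, by simp⟩
    rw [this]
    exact add_mem (Submodule.smul_mem_smul ha trivial) (Submodule.smul_mem_smul hb trivial)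
  have h1 := h _ hRD ⟨hgen, _, rfl⟩
  rw [ideal_smul_range] at h1
  obtain ⟨g, hg, he⟩ := h1
  rw [hinj he] at hg
  obtain ⟨t, ht1, ht2⟩ := DivisionModule.gen_mem_smul_top hg
  -- The sum is congruent to 1 modulo `A ≤ P`, so locality makes one term a unit; its `r` is then
  -- the common divisor.
  obtain ⟨q, hq⟩ : ∃ q, IsUnit (t q * q.1.2) := by
    by_contra! hcon
    have h2 : ∑ q ∈ t.support, t q * q.1.2 ∈ IsLocalRing.maximalIdeal R :=
      Ideal.sum_mem _ fun q _ => hcon q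
    have h3 := add_mem (IsLocalRing.le_maximalIdeal hA ht1) h2
    rw [sub_add_cancel] at h3
    exact h3 isUnit_one
  have hs := isUnit_of_mul_isUnit_right hq
  exact ⟨q.1.1, (Ideal.unit_mul_mem_iff_mem A (isUnit_of_mul_isUnit_left hq)).1 (ht2 q),
    hs.dvd_mul_left.1 q.2.1, hs.dvd_mul_left.1 q.2.2⟩

theorem isRDFlat_quotient_iff_directed [IsLocalRing R] {A : Ideal R} (hA : A ≠ ⊤) :
    IsRDFlat R (R ⧸ A) ↔ ∀ a ∈ A, ∀ b ∈ A, ∃ c ∈ A, c ∣ a ∧ c ∣ b :=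
  ⟨fun h _ ha _ hb => exists_dvd_of_isRDFlat_quotient hA h ha hb, isRDFlat_quotient_of_directed⟩

end RD

/-! ### Extension problems modulo `A`. -/

section Reduction

variable {R : Type u} [CommRing R]

theorem mkQ_smul_eq_zero (A : Ideal R) {M : Type u} [AddCommGroup M] [Module R M] {a : R}
    (ha : a ∈ A) (x : M ⧸ (A • (⊤ : Submodule R M))) : a • x = 0 := by
  obtain ⟨m, rfl⟩ := Submodule.mkQ_surjective _ x
  rw [← map_smul, Submodule.mkQ_apply, Submodule.Quotient.mk_eq_zero]
  exact Submodule.smul_mem_smul ha trivial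

/-- A map from `N ≤ M` to a module killed by `A` factors through the image of `N` in `M ⧸ A M`
when `A M ∩ N = A N`. -/
theorem exists_factor_map_mkQ {A : Ideal R} {M F : Type u} [AddCommGroup M] [Module R M]
    [AddCommGroup F] [Module R F] (hF : ∀ a ∈ A, ∀ x : F, a • x = 0) {N : Submodule R M}
    (hN : (A • (⊤ : Submodule R M)) ⊓ N ≤ A • N) (φ : N →ₗ[R] F) :
    ∃ φ' : N.map (A • (⊤ : Submodule R M)).mkQ →ₗ[R] F,
      ∀ (n : M) (hn : n ∈ N), φ' ⟨Submodule.Quotient.mk n, n, hn, rfl⟩ = φ ⟨n, hn⟩ := by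
  let q := (A • (⊤ : Submodule R M)).mkQ.submoduleMap N
  have hker : LinearMap.ker q ≤ LinearMap.ker φ := by
    rintro ⟨n, hn⟩ h
    have h1 : n ∈ A • (⊤ : Submodule R M) := by
      rw [← Submodule.Quotient.mk_eq_zero]
      exact congrArg Subtype.val h
    have h2 := hN ⟨h1, hn⟩
    have h3 : A • N = (A • (⊤ : Submodule R N)).map N.subtype := by
      rw [← ideal_smul_range, Submodule.range_subtype]
    rw [h3] at h2
    obtain ⟨m, hm, rfl⟩ := h2
    refine Submodule.smul_induction_on hm (p := fun m => φ m = 0) (fun a ha x _ => ?_)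
      (fun x y hx hy => ?_)
    · rw [map_smul, hF a ha]
    · rw [map_add, hx, hy, add_zero]
  let e := q.quotKerEquivOfSurjective (LinearMap.submoduleMap_surjective _ N)
  refine ⟨(LinearMap.ker q).liftQ φ hker ∘ₗ e.symm.toLinearMap, fun n hn => ?_⟩
  have : e.symm ⟨Submodule.Quotient.mk n, n, hn, rfl⟩ = Submodule.Quotient.mk ⟨n, hn⟩ :=
    e.symm_apply_eq.2 rfl
  simp [this]

theorem isRDInjective_of_extend_mod {A : Ideal R} (hA : IsRDFlat R (R ⧸ A)) {F : Type u}
    [AddCommGroup F] [Module R F] (hF : ∀ a ∈ A, ∀ x : F, a • x = 0)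
    (h : ∀ ⦃M : Type u⦄ [AddCommGroup M] [Module R M] (N : Submodule R M), IsRDSubmodule N →
      ∀ φ : N.map (A • (⊤ : Submodule R M)).mkQ →ₗ[R] F,
      ∃ ψ : (M ⧸ (A • (⊤ : Submodule R M))) →ₗ[R] F,
        ∀ n : N.map (A • (⊤ : Submodule R M)).mkQ, ψ n = φ n) : IsRDInjective R F := by
  rw [isRDInjective_iff]
  rw [isRDFlat_quotient_iff] at hA
  intro M _ _ N hN φ
  obtain ⟨φ', hφ'⟩ := exists_factor_map_mkQ hF (hA N hN) φ
  obtain ⟨ψ, hψ⟩ := h N hN φ'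
  refine ⟨ψ ∘ₗ Submodule.mkQ _, fun n => ?_⟩
  have := hψ ⟨Submodule.Quotient.mk n, n, n.2, rfl⟩
  rwa [hφ'] at this

theorem isRDInjective_of_injective_quotient {A : Ideal R} (hA : IsRDFlat R (R ⧸ A)) {F : Type u}
    [AddCommGroup F] [Module R F] (hF : Module.IsTorsionBySet R F A)
    (h : @Module.Injective (R ⧸ A) _ F _ hF.module) : IsRDInjective R F := by
  refine isRDInjective_of_extend_mod hA (fun a ha x => @hF x ⟨a, ha⟩) ?_
  intro M _ _ N _ φ
  have hQ : Module.IsTorsionBySet R (M ⧸ (A • (⊤ : Submodule R M))) A :=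
    fun x a => mkQ_smul_eq_zero A a.2 x
  have hK : Module.IsTorsionBySet R (N.map (A • (⊤ : Submodule R M)).mkQ) A :=
    fun x a => Subtype.ext (mkQ_smul_eq_zero A a.2 x.1)
  let _ := hF.module
  let _ := hQ.module
  let _ := hK.module
  -- An `R`-linear map between modules killed by `A` is automatically linear over `R ⧸ A`.
  have lin {X Y : Type u} [AddCommGroup X] [Module R X] [AddCommGroup Y] [Module R Y]
      (hX : Module.IsTorsionBySet R X A) (hY : Module.IsTorsionBySet R Y A) (f : X →ₗ[R] Y)
      (c : R ⧸ A) (x : X) : f (hX.module.toSMul.smul c x) = hY.module.toSMul.smul c (f x) := by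
    obtain ⟨r, rfl⟩ := Ideal.Quotient.mk_surjective c
    exact map_smul f r x
  let i : N.map (A • (⊤ : Submodule R M)).mkQ →ₗ[R ⧸ A] (M ⧸ (A • (⊤ : Submodule R M))) :=
    { toFun := fun x => x.1
      map_add' := fun _ _ => rfl
      map_smul' := lin hK hQ (Submodule.subtype _) }
  let φ₁ : N.map (A • (⊤ : Submodule R M)).mkQ →ₗ[R ⧸ A] F :=
    { toFun := φ
      map_add' := map_add φ
      map_smul' := lin hK hF φ }
  obtain ⟨ψ, hψ⟩ := h.out i Subtype.val_injective φ₁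
  exact ⟨{ toFun := ψ
           map_add' := map_add ψ
           map_smul' := fun r x => ψ.map_smul (Ideal.Quotient.mk A r) x }, hψ⟩

end Reduction

/-! ### Annihilators in the injective hull of the residue field. -/

section Hull

variable {R : Type u} [CommRing R]

/-- A map from `M ⧸ A M` to `E` is killed by `A`, so an extension into `E` already lands in the
annihilator. -/
theorem isRDInjective_torsionBySet_of_injective {A : Ideal R} (hA : IsRDFlat R (R ⧸ A))
    {E : Type u} [AddCommGroup E] [Module R E] (hE : Module.Injective R E) :
    IsRDInjective R (Submodule.torsionBySet R E A) := by
  refine isRDInjective_of_extend_mod hA (fun a ha x => Subtype.ext ?_) ?_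
  · exact (Submodule.mem_torsionBySet_iff _ _).1 x.2 ⟨a, ha⟩
  · intro M _ _ N _ φ
    obtain ⟨ψ, hψ⟩ := hE.out (Submodule.subtype _) (Submodule.injective_subtype _)
      (Submodule.subtype _ ∘ₗ φ)
    refine ⟨ψ.codRestrict _ fun x => ?_, fun n => Subtype.ext (hψ n)⟩
    rw [Submodule.mem_torsionBySet_iff]
    rintro ⟨a, ha⟩
    rw [← map_smul, mkQ_smul_eq_zero A ha, map_zero]

variable [IsLocalRing R]

/-- The annihilator of `x ≠ 0` lies in the maximal ideal, so `R x` maps onto the residue field; this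
map extends to `X`. -/
theorem exists_apply_ne_zero {E : Type u} [AddCommGroup E]
    [Module R E] (i : (R ⧸ IsLocalRing.maximalIdeal R) →ₗ[R] E) (hi : IsInjectiveHull i)
    {X : Type u} [AddCommGroup X] [Module R X] {x : X} (hx : x ≠ 0) :
    ∃ φ : X →ₗ[R] E, φ x ≠ 0 := by
  let t := LinearMap.toSpanSingleton R X x
  have hker : LinearMap.ker t ≤ IsLocalRing.maximalIdeal R := by
    apply IsLocalRing.le_maximalIdeal
    rw [Ne, Ideal.eq_top_iff_one, LinearMap.mem_ker]
    simpa [t] using hx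
  obtain ⟨φ, hφ⟩ := hi.1.out ((LinearMap.ker t).liftQ t le_rfl)
    (by rw [← LinearMap.ker_eq_bot]; exact Submodule.ker_liftQ_eq_bot _ _ _ le_rfl)
    (i ∘ₗ (LinearMap.ker t).mapQ (IsLocalRing.maximalIdeal R) LinearMap.id hker)
  refine ⟨φ, fun h => ?_⟩
  have h1 := hφ (Submodule.Quotient.mk 1)
  simp only [Submodule.liftQ_apply, LinearMap.comp_apply, Submodule.mapQ_apply,
    LinearMap.id_apply, t, LinearMap.toSpanSingleton_apply, one_smul, h] at h1
  have h2 := hi.2.1 (h1.symm.trans (map_zero i).symm)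
  rw [Submodule.Quotient.mk_eq_zero] at h2
  exact h2 isUnit_one

/-- If `x ∈ A M ∩ N` were outside `A N`, a map `N ⧸ A N → E` nonzero at `x` would extend to a map
from `M` into the annihilator of `A`, which vanishes on `A M`. -/
theorem isRDFlat_quotient_of_isRDInjective_torsionBySet {A : Ideal R} {E : Type u}
    [AddCommGroup E] [Module R E] (i : (R ⧸ IsLocalRing.maximalIdeal R) →ₗ[R] E)
    (hi : IsInjectiveHull i) (h : IsRDInjective R (Submodule.torsionBySet R E A)) :
    IsRDFlat R (R ⧸ A) := by
  rw [isRDFlat_quotient_iff]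
  rw [isRDInjective_iff] at h
  rintro M _ _ N hN x ⟨hx, hxN⟩
  by_contra hcon
  have hne : Submodule.Quotient.mk (p := A • (⊤ : Submodule R N)) (⟨x, hxN⟩ : N) ≠ 0 := by
    rw [Ne, Submodule.Quotient.mk_eq_zero]
    intro h1
    have := Submodule.mem_map_of_mem (f := N.subtype) h1
    rw [← ideal_smul_range, Submodule.range_subtype] at this
    exact hcon this
  obtain ⟨φ, hφ⟩ := exists_apply_ne_zero i hi hne
  obtain ⟨ψ, hψ⟩ := h N hN ((φ ∘ₗ Submodule.mkQ _).codRestrict _ fun n => by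
    rw [Submodule.mem_torsionBySet_iff]
    rintro ⟨a, ha⟩
    rw [LinearMap.comp_apply, ← map_smul, mkQ_smul_eq_zero A ha, map_zero])
  refine hφ ?_
  have h1 : φ (Submodule.Quotient.mk ⟨x, hxN⟩) = (ψ x : E) :=
    (congrArg Subtype.val (hψ ⟨x, hxN⟩)).symm
  rw [h1]
  refine Submodule.smul_induction_on hx (p := fun m => (ψ m : E) = 0) (fun a ha x _ => ?_)
    (fun x y hx hy => ?_)
  · rw [map_smul]
    exact (Submodule.mem_torsionBySet_iff _ _).1 (ψ x).2 ⟨a, ha⟩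
  · rw [map_add, Submodule.coe_add, hx, hy, add_zero]

/-- By essentiality a nonzero `x` killed by `P` has a nonzero multiple `r x` in the range; `r` must
be a unit. -/
theorem range_eq_torsionBySet_maximalIdeal {E : Type u} [AddCommGroup E] [Module R E]
    (i : (R ⧸ IsLocalRing.maximalIdeal R) →ₗ[R] E) (hi : IsInjectiveHull i) :
    LinearMap.range i = Submodule.torsionBySet R E (IsLocalRing.maximalIdeal R) := by
  apply le_antisymm
  · rintro _ ⟨y, rfl⟩
    rw [Submodule.mem_torsionBySet_iff]
    rintro ⟨a, ha⟩
    obtain ⟨r, rfl⟩ := Submodule.mkQ_surjective _ y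
    rw [← map_smul, ← map_smul, Submodule.mkQ_apply, (Submodule.Quotient.mk_eq_zero _).2, map_zero]
    exact Ideal.mul_mem_right _ _ ha
  · intro x hx
    by_cases hx0 : x = 0
    · exact hx0 ▸ zero_mem _
    have h1 : Submodule.span R {x} ⊓ LinearMap.range i ≠ ⊥ := fun h =>
      hx0 (by simpa using hi.2.2 _ h)
    obtain ⟨y, ⟨hy, hyi⟩, hy0⟩ := Submodule.exists_mem_ne_zero_of_ne_bot h1
    obtain ⟨r, rfl⟩ := Submodule.mem_span_singleton.1 hy
    have hr : IsUnit r := by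
      by_contra hr
      exact hy0 ((Submodule.mem_torsionBySet_iff _ _).1 hx ⟨r, hr⟩)
    exact (Submodule.smul_mem_iff_of_isUnit _ hr).1 hyi

theorem isRDInjective_residue_iff :
    IsRDInjective R (R ⧸ IsLocalRing.maximalIdeal R) ↔
      IsRDFlat R (R ⧸ IsLocalRing.maximalIdeal R) := by
  have hi := injectiveHull.isInjectiveHull R (R ⧸ IsLocalRing.maximalIdeal R)
  let e := (LinearEquiv.ofInjective _ hi.2.1).trans
    (LinearEquiv.ofEq _ _ (range_eq_torsionBySet_maximalIdeal _ hi))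
  exact ⟨fun h => isRDFlat_quotient_of_isRDInjective_torsionBySet _ hi (h.of_linearEquiv e),
    fun h => (isRDInjective_torsionBySet_of_injective h hi.1).of_linearEquiv e.symm⟩

end Hull

/-! ### Principal maximal ideal: divisible and bounded modules. -/

section PrincipalMaximal

variable {R : Type u} [CommRing R] [IsLocalRing R]

theorem pow_dvd_or_eq_pow_mul {p : R}
    (hp : IsLocalRing.maximalIdeal R = Ideal.span {p}) (n : ℕ) (r : R) :
    p ^ n ∣ r ∨ ∃ k < n, ∃ u : Rˣ, r = p ^ k * u := by
  induction n with
  | zero => simp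
  | succ n ih =>
    rcases ih with ⟨s, rfl⟩ | ⟨k, hk, u, rfl⟩
    · by_cases hs : IsUnit s
      · obtain ⟨u, rfl⟩ := hs
        exact Or.inr ⟨n, n.lt_succ_self, u, rfl⟩
      · have : s ∈ Ideal.span {p} := hp ▸ hs
        obtain ⟨t, rfl⟩ := Ideal.mem_span_singleton.1 this
        exact Or.inl ⟨t, by ring⟩
    · exact Or.inr ⟨k, hk.trans n.lt_succ_self, u, rfl⟩

theorem mem_maximalIdeal_pow_iff {p : R}
    (hp : IsLocalRing.maximalIdeal R = Ideal.span {p}) {n : ℕ} {r : R} :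
    r ∈ IsLocalRing.maximalIdeal R ^ n ↔ p ^ n ∣ r := by
  rw [hp, Ideal.span_singleton_pow, Ideal.mem_span_singleton]

theorem eq_pow_mul_of_notMem_iInf {p : R}
    (hp : IsLocalRing.maximalIdeal R = Ideal.span {p}) {r : R} (hr : r ∉ ⨅ n : ℕ, IsLocalRing.maximalIdeal R ^ n) :
    ∃ k : ℕ, ∃ u : Rˣ, r = p ^ k * u := by
  simp only [Submodule.mem_iInf, not_forall, mem_maximalIdeal_pow_iff hp] at hr
  obtain ⟨n, hn⟩ := hr
  obtain ⟨k, -, u, h⟩ := (pow_dvd_or_eq_pow_mul hp n r).resolve_left hn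
  exact ⟨k, u, h⟩

/-- Baer's criterion: a nonzero ideal of `R/J` is generated by the least power `p ^ m` it contains,
and the value at `p ^ m` can be divided by `p ^ m` in `D`. -/
theorem injective_of_divisible {p : R}
    (hp : IsLocalRing.maximalIdeal R = Ideal.span {p}) {D : Type u} [AddCommGroup D] [Module R D]
    (hD : ∀ x : D, ∃ y : D, p • y = x)
    (hJ : Module.IsTorsionBySet R D (⨅ n : ℕ, IsLocalRing.maximalIdeal R ^ n : Ideal R)) :
    @Module.Injective (R ⧸ ⨅ n : ℕ, IsLocalRing.maximalIdeal R ^ n) _ D _ hJ.module := by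
  let _ := hJ.module
  have hpow : ∀ n : ℕ, ∀ x : D, ∃ y : D, p ^ n • y = x := by
    intro n
    induction n with
    | zero => exact fun x => ⟨x, by simp⟩
    | succ n ih =>
      intro x
      obtain ⟨y, rfl⟩ := ih x
      obtain ⟨z, rfl⟩ := hD y
      exact ⟨z, by rw [pow_succ, mul_smul]⟩
  have hsmul : ∀ (r : R) (x : D),
      (Ideal.Quotient.mk (⨅ n : ℕ, IsLocalRing.maximalIdeal R ^ n) r) • x = r • x := fun _ _ => rfl
  refine Module.Baer.injective fun I g => ?_
  by_cases hI : I = ⊥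
  · subst hI
    refine ⟨0, fun x hx => ?_⟩
    obtain rfl : x = 0 := hx
    rw [LinearMap.zero_apply]
    exact (map_zero g).symm
  obtain ⟨x, hx, hx0⟩ := Submodule.exists_mem_ne_zero_of_ne_bot hI
  obtain ⟨r, rfl⟩ := Ideal.Quotient.mk_surjective x
  have hex : ∃ k : ℕ, Ideal.Quotient.mk (⨅ n : ℕ, IsLocalRing.maximalIdeal R ^ n) (p ^ k) ∈ I := by
    obtain ⟨k, u, rfl⟩ := eq_pow_mul_of_notMem_iInf hp (mt Ideal.Quotient.eq_zero_iff_mem.2 hx0)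
    rw [map_mul, Ideal.mul_unit_mem_iff_mem _ (u.isUnit.map _)] at hx
    exact ⟨k, hx⟩
  obtain ⟨m, hm, hmin⟩ : ∃ k : ℕ,
      Ideal.Quotient.mk (⨅ n : ℕ, IsLocalRing.maximalIdeal R ^ n) (p ^ k) ∈ I ∧
      ∀ j < k, Ideal.Quotient.mk (⨅ n : ℕ, IsLocalRing.maximalIdeal R ^ n) (p ^ j) ∉ I := by
    classical exact ⟨Nat.find hex, Nat.find_spec hex, fun _ => Nat.find_min hex⟩
  obtain ⟨d, hd⟩ := hpow m (g ⟨_, hm⟩)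
  refine ⟨LinearMap.toSpanSingleton _ _ d, fun x hx => ?_⟩
  obtain ⟨s, rfl⟩ := Ideal.Quotient.mk_surjective x
  rcases pow_dvd_or_eq_pow_mul hp m s with ⟨t, rfl⟩ | ⟨k, hk, u, rfl⟩
  · have : (⟨_, hx⟩ : I) =
        Ideal.Quotient.mk (⨅ n : ℕ, IsLocalRing.maximalIdeal R ^ n) t • ⟨_, hm⟩ :=
      Subtype.ext (by simp [mul_comm])
    rw [this, map_smul, ← hd, LinearMap.toSpanSingleton_apply, hsmul, hsmul, smul_smul, mul_comm]
  · rw [map_mul, Ideal.mul_unit_mem_iff_mem _ (u.isUnit.map _)] at hx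
    exact absurd hx (hmin k hk)

/-- An RD-submodule of a bounded module is a direct summand. -/
theorem IsRDSubmodule.exists_isCompl {p : R}
    (hp : IsLocalRing.maximalIdeal R = Ideal.span {p}) {M : Type u} [AddCommGroup M] [Module R M] {n : ℕ}
    (hM : ∀ x : M, p ^ n • x = 0) {N : Submodule R M} (hN : IsRDSubmodule N) :
    ∃ K : Submodule R M, IsCompl N K := by
  -- Maximality is taken among `K` for which `T = N ⊕ K` is still relatively divisible; if `T ≠ M`,
  -- a cyclic summand can be added.
  obtain ⟨K, -, hK⟩ := zorn_le_nonempty₀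
    {K : Submodule R M | N ⊓ K = ⊥ ∧ IsRDSubmodule (N ⊔ K)} (by
      intro c hc hchain y hy
      have hmem : ∀ x ∈ sSup c, ∃ K ∈ c, x ∈ K := fun x hx =>
        (Submodule.mem_sSup_of_directed ⟨y, hy⟩ hchain.directedOn).1 hx
      refine ⟨sSup c, ⟨?_, ?_⟩, fun z hz => le_sSup hz⟩
      · rw [Submodule.eq_bot_iff]
        rintro x ⟨hxN, hx⟩
        obtain ⟨K, hK, hxK⟩ := hmem x hx
        exact (Submodule.eq_bot_iff _).1 (hc hK).1 x ⟨hxN, hxK⟩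
      · rw [isRDSubmodule_iff]
        intro r m hm
        obtain ⟨a, ha, b, hb, hab⟩ := Submodule.mem_sup.1 hm
        obtain ⟨K, hK, hbK⟩ := hmem b hb
        obtain ⟨z, hz, he⟩ := isRDSubmodule_iff.1 (hc hK).2 r m
          (hab ▸ Submodule.add_mem_sup ha hbK)
        exact ⟨z, sup_le_sup_left (le_sSup hK) N hz, he⟩) ⊥ ⟨inf_bot_eq N, by simpa using hN⟩
  have hT := isRDSubmodule_iff.1 hK.prop.2
  have hNK := (Submodule.eq_bot_iff _).1 hK.prop.1
  refine ⟨K, disjoint_iff.2 hK.prop.1, codisjoint_iff.2 ?_⟩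
  by_contra htop
  have hex : ∃ k, ∀ y : M, p ^ k • y ∈ N ⊔ K := ⟨n, fun y => hM y ▸ zero_mem _⟩
  -- `p ^ k` is the exact exponent of `M/T`. Relative divisibility of `T` corrects an element of
  -- that order to an `x` with `p ^ k x = 0`, so that `R x ∩ T = 0`.
  obtain ⟨k, hk, hkmin⟩ : ∃ k, (∀ y : M, p ^ k • y ∈ N ⊔ K) ∧
      ∀ j < k, ¬ ∀ y : M, p ^ j • y ∈ N ⊔ K := by
    classical exact ⟨Nat.find hex, Nat.find_spec hex, fun _ => Nat.find_min hex⟩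
  have hk0 : 0 < k := by
    rw [Nat.pos_iff_ne_zero]
    rintro rfl
    exact htop (Submodule.eq_top_iff'.2 fun y => by simpa using hk y)
  obtain ⟨x₀, hx₀⟩ := not_forall.1 (hkmin (k - 1) (by omega))
  obtain ⟨t₀, ht₀, he₀⟩ := hT _ _ (hk x₀)
  obtain ⟨x, hx, hxT⟩ : ∃ x : M, p ^ k • x = 0 ∧ p ^ (k - 1) • x ∉ N ⊔ K := by
    refine ⟨x₀ - t₀, by rw [smul_sub, he₀, sub_self], fun h => hx₀ ?_⟩
    rw [smul_sub] at h
    exact (Submodule.sub_mem_iff_left _ (Submodule.smul_mem _ _ ht₀)).1 h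
  have hnot : ∀ j < k, ∀ u : Rˣ, (p ^ j * u) • x ∉ N ⊔ K := by
    intro j hj u h
    rw [mul_comm, mul_smul, Submodule.smul_mem_iff_of_isUnit _ u.isUnit] at h
    refine hxT ?_
    have : k - 1 = (k - 1 - j) + j := by omega
    rw [this, pow_add, mul_smul]
    exact Submodule.smul_mem _ _ h
  have hzero : ∀ s : R, s • x ∈ N ⊔ K → s • x = 0 := by
    intro s hs
    rcases pow_dvd_or_eq_pow_mul hp k s with ⟨t, rfl⟩ | ⟨j, hj, u, rfl⟩
    · rw [mul_comm, mul_smul, hx, smul_zero]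
    · exact absurd hs (hnot j hj u)
  have hmem : K ⊔ Submodule.span R {x} ∈
      {K : Submodule R M | N ⊓ K = ⊥ ∧ IsRDSubmodule (N ⊔ K)} := by
    constructor
    · rw [Submodule.eq_bot_iff]
      rintro y ⟨hyN, hy⟩
      obtain ⟨z, hz, _, hw, rfl⟩ := Submodule.mem_sup.1 hy
      obtain ⟨s, rfl⟩ := Submodule.mem_span_singleton.1 hw
      have hs : s • x = 0 := hzero s (by
        rw [← add_sub_cancel_left z (s • x)]
        exact sub_mem (le_sup_left (a := N) hyN) (le_sup_right (a := N) hz))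
      rw [hs, add_zero] at hyN ⊢
      exact hNK z ⟨hyN, hz⟩
    · rw [← sup_assoc, isRDSubmodule_iff]
      intro r y hry
      rcases pow_dvd_or_eq_pow_mul hp k r with ⟨t, rfl⟩ | ⟨i, hi, u, rfl⟩
      · obtain ⟨z, hz, he⟩ := hT (p ^ k * t) y (by rw [mul_smul]; exact hk _)
        exact ⟨z, Submodule.mem_sup_left hz, he⟩
      · obtain ⟨t, ht, _, hw, he⟩ := Submodule.mem_sup.1 hry
        obtain ⟨s, rfl⟩ := Submodule.mem_span_singleton.1 hw
        -- In `r y = t + s x` with `r = p ^ i u` and `i < k`: if `p ^ i` divides `s`, then `s x` is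
        -- absorbed into `r y`. Otherwise `s = p ^ j v` with `j < i`, and multiplying by `p ^ (k -
        -- i)` puts `p ^ (k - i + j) v x` in `T`, although the exponent is below `k`.
        rcases pow_dvd_or_eq_pow_mul hp i s with ⟨c, rfl⟩ | ⟨j, hj, v, rfl⟩
        · have h1 : (p ^ i * c) • x = (p ^ i * u) • ((↑u⁻¹ * c) • x) := by
            rw [smul_smul, mul_assoc, ← mul_assoc (u : R), Units.mul_inv, one_mul]
          obtain ⟨z, hz, hz'⟩ := hT (p ^ i * u) (y - (↑u⁻¹ * c) • x) (by
            rwa [smul_sub, ← h1, ← he, add_sub_cancel_right])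
          refine ⟨z + (↑u⁻¹ * c) • x, Submodule.add_mem_sup hz
            (Submodule.smul_mem _ _ (Submodule.mem_span_singleton_self x)), ?_⟩
          rw [smul_add, hz', smul_sub, sub_add_cancel]
        · refine absurd ?_ (hnot (k - i + j) (by omega) v)
          have h1 : p ^ (k - i) • (p ^ i * (u : R)) • y ∈ N ⊔ K := by
            rw [smul_smul, ← mul_assoc, ← pow_add, Nat.sub_add_cancel hi.le, mul_smul]
            exact hk _
          rw [← he, smul_add, smul_smul, ← mul_assoc, ← pow_add] at h1
          exact (Submodule.add_mem_iff_right _ (Submodule.smul_mem _ _ ht)).1 h1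
  have hxK : x ∈ K := hK.le_of_ge hmem le_sup_left
    (Submodule.mem_sup_right (Submodule.mem_span_singleton_self x))
  exact hxT (Submodule.smul_mem _ _ (Submodule.mem_sup_right hxK))

/-- Either `p ^ n` divides `r`, and `r` kills the quotient, or `r = p ^ k u` with `k < n`, and the
error in `p ^ n M` is itself a multiple of `r`. -/
theorem IsRDSubmodule.map_mkQ_span_pow {p : R}
    (hp : IsLocalRing.maximalIdeal R = Ideal.span {p}) {M : Type u} [AddCommGroup M] [Module R M] (n : ℕ)
    {N : Submodule R M} (hN : IsRDSubmodule N) :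
    IsRDSubmodule (N.map (Ideal.span {p ^ n} • (⊤ : Submodule R M)).mkQ) := by
  rw [isRDSubmodule_iff] at *
  rintro r m ⟨a, ha, he⟩
  obtain ⟨m, rfl⟩ := Submodule.mkQ_surjective _ m
  rcases pow_dvd_or_eq_pow_mul hp n r with h | ⟨k, hk, u, rfl⟩
  · refine ⟨0, zero_mem _, ?_⟩
    rw [smul_zero, mkQ_smul_eq_zero _ (Ideal.mem_span_singleton.2 h)]
  · rw [← map_smul, Submodule.mkQ_apply, Submodule.mkQ_apply, Submodule.Quotient.eq,
      Submodule.ideal_span_singleton_smul, Submodule.mem_smul_pointwise_iff_exists] at he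
    obtain ⟨y, -, hy⟩ := he
    have h1 : p ^ n • y = (p ^ k * u) • ((↑u⁻¹ * p ^ (n - k)) • y) := by
      rw [smul_smul, mul_assoc, ← mul_assoc (u : R), Units.mul_inv, one_mul, ← pow_add,
        Nat.add_sub_cancel' hk.le]
    have h2 : a = (p ^ k * u) • (m + (↑u⁻¹ * p ^ (n - k)) • y) := by
      rw [smul_add, ← h1, hy, add_sub_cancel]
    obtain ⟨z, hz, hz'⟩ := hN _ _ (h2 ▸ ha)
    refine ⟨Submodule.Quotient.mk z, ⟨z, hz, rfl⟩, ?_⟩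
    rw [← map_smul, ← Submodule.Quotient.mk_smul, hz', Submodule.mkQ_apply, Submodule.Quotient.eq,
      ← smul_sub, add_sub_cancel_left, ← h1]
    exact Submodule.smul_mem_smul (Ideal.mem_span_singleton_self _) trivial

theorem isRDInjective_of_pow_smul_eq_zero {p : R}
    (hp : IsLocalRing.maximalIdeal R = Ideal.span {p}) {C : Type u} [AddCommGroup C] [Module R C] {n : ℕ}
    (hC : ∀ x : C, p ^ n • x = 0) : IsRDInjective R C := by
  refine isRDInjective_of_extend_mod (A := Ideal.span {p ^ n})
    (isRDFlat_quotient_of_directed fun a ha b hb => ⟨p ^ n, Ideal.mem_span_singleton_self _,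
      Ideal.mem_span_singleton.1 ha, Ideal.mem_span_singleton.1 hb⟩) ?_ ?_
  · intro a ha x
    obtain ⟨c, rfl⟩ := Ideal.mem_span_singleton.1 ha
    rw [mul_comm, mul_smul, hC, smul_zero]
  · intro M _ _ N hN φ
    obtain ⟨K, hK⟩ := (hN.map_mkQ_span_pow hp n).exists_isCompl hp (n := n)
      (fun x => mkQ_smul_eq_zero _ (Ideal.mem_span_singleton_self _) x)
    exact ⟨LinearMap.ofIsCompl hK φ 0, fun x => LinearMap.ofIsCompl_apply_left hK x⟩

end PrincipalMaximal

/-! ### Artinian modules over a local ring. -/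

section LocalRing

variable {R : Type u} [CommRing R] [IsLocalRing R]

open IsLocalRing

/-- `R x` is artinian, so `R ⧸ ann x` is an artinian local ring with nilpotent maximal ideal. -/
theorem exists_pow_maximalIdeal_smul_eq_zero {M : Type u} [AddCommGroup M] [Module R M]
    [IsArtinian R M] (x : M) : ∃ n : ℕ, ∀ a ∈ maximalIdeal R ^ n, a • x = 0 := by
  let t := LinearMap.toSpanSingleton R M x
  have : IsArtinian R (R ⧸ LinearMap.ker t) :=
    isArtinian_of_injective ((LinearMap.ker t).liftQ t le_rfl)
      (by rw [← LinearMap.ker_eq_bot]; exact Submodule.ker_liftQ_eq_bot _ _ _ le_rfl)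
  have : IsArtinianRing (R ⧸ LinearMap.ker t) := isArtinian_of_tower R this
  obtain ⟨n, hn⟩ := exists_maximalIdeal_pow_le_of_isArtinianRing_quotient (LinearMap.ker t)
  exact ⟨n, fun a ha => hn ha⟩

theorem isTorsionBySet_iInf_pow_of_isArtinian {M : Type u} [AddCommGroup M] [Module R M]
    [IsArtinian R M] :
    Module.IsTorsionBySet R M (⨅ n : ℕ, maximalIdeal R ^ n : Ideal R) := by
  rintro x ⟨a, ha⟩
  obtain ⟨n, hn⟩ := exists_pow_maximalIdeal_smul_eq_zero (R := R) x
  exact hn a ((Submodule.mem_iInf _).1 ha n)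

/-- If `P = P ^ 2`, all positive powers agree. Otherwise take `p ∈ P` outside `P ^ 2`: a divisor of
`p` in `P` is associate to `p`, so `p` divides every `a ∈ P`. -/
theorem maximalIdeal_eq_span_or_iInf_pow_eq
    (h : ∀ a ∈ maximalIdeal R, ∀ b ∈ maximalIdeal R, ∃ c ∈ maximalIdeal R, c ∣ a ∧ c ∣ b) :
    (∃ p, maximalIdeal R = Ideal.span {p}) ∨ ⨅ n : ℕ, maximalIdeal R ^ n = maximalIdeal R := by
  by_cases hP : maximalIdeal R ≤ maximalIdeal R ^ 2
  · right
    have hidem : IsIdempotentElem (maximalIdeal R) := by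
      rw [pow_two] at hP
      exact le_antisymm Ideal.mul_le_left hP
    refine le_antisymm ((iInf_le _ 1).trans (pow_one _).le) (le_iInf fun n => ?_)
    rcases n with _ | n
    · simp
    · rw [hidem.pow_succ_eq]
  · left
    obtain ⟨p, hp, hp2⟩ := SetLike.not_le_iff_exists.1 hP
    refine ⟨p, le_antisymm (fun a ha => ?_) (by simpa [Ideal.span_le] using hp)⟩
    obtain ⟨c, hc, ⟨u, rfl⟩, hca⟩ := h p hp a ha
    have hu : IsUnit u := by
      by_contra hu
      refine hp2 ?_
      rw [pow_two]
      exact Ideal.mul_mem_mul hc hu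
    rw [Ideal.mem_span_singleton]
    exact hu.mul_right_dvd.2 hca

theorem isRDInjective_of_isTorsionBySet_maximalIdeal
    (hP : IsRDFlat R (R ⧸ maximalIdeal R)) {M : Type u} [AddCommGroup M] [Module R M]
    (hM : Module.IsTorsionBySet R M (maximalIdeal R)) : IsRDInjective R M := by
  refine isRDInjective_of_injective_quotient hP hM ?_
  let _ := Ideal.Quotient.field (maximalIdeal R)
  let _ := hM.module
  exact Module.injective_of_isSemisimpleRing _ _

theorem isRDInjective_of_isArtinian_of_principal {p : R}
    (hp : maximalIdeal R = Ideal.span {p})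
    (hJ : IsRDFlat R (R ⧸ ⨅ n : ℕ, maximalIdeal R ^ n))
    {M : Type u} [AddCommGroup M] [Module R M] [IsArtinian R M] : IsRDInjective R M := by
  have htors := isTorsionBySet_iInf_pow_of_isArtinian (R := R) (M := M)
  obtain ⟨n, hn⟩ := IsArtinian.range_smul_pow_stabilizes M p
  let D : Submodule R M := LinearMap.range (p ^ n • LinearMap.id : M →ₗ[R] M)
  have hpow : ∀ (k : ℕ) (d : D), ∃ d' : D, p ^ k • d' = d := by
    rintro k ⟨d, hd⟩
    change d ∈ LinearMap.range _ at hd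
    rw [hn (k + n) (Nat.le_add_left n k)] at hd
    obtain ⟨m, rfl⟩ := hd
    exact ⟨⟨_, m, rfl⟩, Subtype.ext (by simp [pow_add, mul_smul])⟩
  have hDinj : IsRDInjective R D := by
    have hDt : Module.IsTorsionBySet R D (⨅ n : ℕ, maximalIdeal R ^ n : Ideal R) :=
      fun x a => Subtype.ext (@htors x.1 a)
    exact isRDInjective_of_injective_quotient hJ hDt
      (injective_of_divisible hp (fun x => by simpa using hpow 1 x) hDt)
  have hDRD : IsRDSubmodule D := by
    rw [isRDSubmodule_iff]
    intro r m hm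
    -- Elements of `J` kill `M`; any other `r` is `p ^ k u`, by which `D` is divisible.
    by_cases hr : r ∈ (⨅ n : ℕ, maximalIdeal R ^ n : Ideal R)
    · exact ⟨0, zero_mem _, by rw [smul_zero, @htors m ⟨r, hr⟩]⟩
    · obtain ⟨k, u, rfl⟩ := eq_pow_mul_of_notMem_iInf hp hr
      obtain ⟨d, hd⟩ := hpow k ⟨_, hm⟩
      refine ⟨(↑u⁻¹ : R) • (d : M), D.smul_mem _ d.2, ?_⟩
      rw [smul_smul, mul_assoc, Units.mul_inv, mul_one]
      exact congrArg Subtype.val hd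
  obtain ⟨e, he⟩ := isRDInjective_iff.1 hDinj D hDRD LinearMap.id
  refine IsRDInjective.of_retract e he hDinj (isRDInjective_of_pow_smul_eq_zero hp (n := n) ?_)
  rintro ⟨c, hc⟩
  -- `p ^ n c` lies in `D`, hence is fixed by `e`, but `e c = 0`; so `p ^ n` kills `ker e`.
  have h1 : e (p ^ n • c) = ⟨p ^ n • c, c, rfl⟩ := he ⟨p ^ n • c, c, rfl⟩
  rw [map_smul, LinearMap.mem_ker.1 hc, smul_zero] at h1
  exact Subtype.ext (congrArg Subtype.val h1).symm

theorem isRDInjective_of_isArtinian (hP : IsRDFlat R (R ⧸ maximalIdeal R))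
    (hJ : IsRDFlat R (R ⧸ ⨅ n : ℕ, maximalIdeal R ^ n))
    {M : Type u} [AddCommGroup M] [Module R M] [IsArtinian R M] : IsRDInjective R M := by
  rcases maximalIdeal_eq_span_or_iInf_pow_eq
    ((isRDFlat_quotient_iff_directed (Ideal.IsPrime.ne_top inferInstance)).1 hP) with ⟨p, hp⟩ | h
  · exact isRDInjective_of_isArtinian_of_principal hp hJ
  · have htors := isTorsionBySet_iInf_pow_of_isArtinian (R := R) (M := M)
    rw [h] at htors
    exact isRDInjective_of_isTorsionBySet_maximalIdeal hP htors

/-! ### Finite length and the submodules of `E[J]`. -/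

theorem isFiniteLength_residue : IsFiniteLength R (R ⧸ maximalIdeal R) := by
  have : IsSimpleModule R (R ⧸ maximalIdeal R) :=
    isSimpleModule_iff_isCoatom.2 (maximalIdeal.isMaximal R).out
  rw [isFiniteLength_iff_isNoetherian_isArtinian]
  exact ⟨inferInstance, inferInstance⟩

/-- Induction on `n`: `R p x` has finite length, and `R x / R p x` is an image of `R/P`. -/
theorem isFiniteLength_span_singleton {p : R} (hp : maximalIdeal R = Ideal.span {p})
    {X : Type u} [AddCommGroup X] [Module R X] (n : ℕ) (x : X) (hx : p ^ n • x = 0) :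
    IsFiniteLength R (Submodule.span R {x}) := by
  rw [isFiniteLength_iff_isNoetherian_isArtinian]
  induction n generalizing x with
  | zero =>
    obtain rfl : x = 0 := by simpa using hx
    rw [Submodule.span_zero_singleton]
    exact ⟨inferInstance, inferInstance⟩
  | succ n ih =>
    obtain ⟨_, _⟩ := ih (p • x) (by rwa [smul_smul, ← pow_succ])
    have hle : Submodule.span R {p • x} ≤ Submodule.span R {x} :=
      Submodule.span_singleton_smul_le R p x
    let f := Submodule.inclusion hle
    let x₁ : Submodule.span R {x} := ⟨x, Submodule.mem_span_singleton_self x⟩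
    let t := (LinearMap.range f).mkQ ∘ₗ LinearMap.toSpanSingleton R _ x₁
    have ht : maximalIdeal R ≤ LinearMap.ker t := by
      intro a ha
      rw [hp, Ideal.mem_span_singleton] at ha
      obtain ⟨c, rfl⟩ := ha
      change Submodule.Quotient.mk ((p * c) • x₁) = 0
      rw [Submodule.Quotient.mk_eq_zero]
      refine ⟨⟨c • p • x, Submodule.smul_mem _ _ (Submodule.mem_span_singleton_self _)⟩,
        Subtype.ext ?_⟩
      change c • p • x = (p * c) • x
      rw [smul_smul, mul_comm]
    have hsurj : Function.Surjective ((maximalIdeal R).liftQ t ht) := by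
      intro y
      obtain ⟨⟨z, hz⟩, rfl⟩ := Submodule.mkQ_surjective _ y
      obtain ⟨c, rfl⟩ := Submodule.mem_span_singleton.1 hz
      exact ⟨Submodule.Quotient.mk c, rfl⟩
    obtain ⟨_, _⟩ := isFiniteLength_iff_isNoetherian_isArtinian.1 (isFiniteLength_residue (R := R))
    have := isNoetherian_of_surjective _ (LinearMap.range_eq_top.2 hsurj)
    have := isArtinian_of_surjective _ _ hsurj
    exact ⟨isNoetherian_of_range_eq_ker f (LinearMap.range f).mkQ (Submodule.ker_mkQ _).symm,
      isArtinian_of_range_eq_ker f (LinearMap.range f).mkQ (Submodule.ker_mkQ _).symm⟩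

theorem mem_span_singleton_of_mem_torsionBySet {E : Type u} [AddCommGroup E] [Module R E]
    (i : (R ⧸ maximalIdeal R) →ₗ[R] E) (hi : IsInjectiveHull i) {z w : E} (hw0 : w ≠ 0)
    (hz : ∀ a ∈ maximalIdeal R, a • z = 0) (hw : ∀ a ∈ maximalIdeal R, a • w = 0) :
    z ∈ Submodule.span R {w} := by
  have hmem : ∀ y : E, (∀ a ∈ maximalIdeal R, a • y = 0) →
      ∃ r : R, i (Submodule.Quotient.mk r) = y := by
    intro y hy
    have h1 : y ∈ LinearMap.range i := by
      rw [range_eq_torsionBySet_maximalIdeal i hi, Submodule.mem_torsionBySet_iff]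
      exact fun a => hy a a.2
    obtain ⟨q, rfl⟩ := h1
    obtain ⟨r, rfl⟩ := Submodule.mkQ_surjective _ q
    exact ⟨r, rfl⟩
  obtain ⟨r, rfl⟩ := hmem z hz
  obtain ⟨s, rfl⟩ := hmem w hw
  have hs : IsUnit s := by
    by_contra hs
    refine hw0 ?_
    rw [(Submodule.Quotient.mk_eq_zero _).2 hs, map_zero]
  obtain ⟨u, rfl⟩ := hs
  refine Submodule.mem_span_singleton.2 ⟨r * ↑u⁻¹, ?_⟩
  rw [← map_smul, ← Submodule.Quotient.mk_smul, smul_eq_mul, mul_assoc, Units.inv_mul, mul_one]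

theorem smul_eq_zero_of_mem_maximalIdeal {p : R} (hp : maximalIdeal R = Ideal.span {p})
    {E : Type u} [AddCommGroup E] [Module R E] {n : ℕ} {x : E} (hx : p ^ (n + 1) • x = 0) :
    ∀ a ∈ maximalIdeal R, a • p ^ n • x = 0 := by
  intro a ha
  rw [hp, Ideal.mem_span_singleton] at ha
  obtain ⟨c, rfl⟩ := ha
  rw [smul_smul, show p * c * p ^ n = c * p ^ (n + 1) by ring, mul_smul, hx, smul_zero]

/-- The socle of `E` is one-dimensional, so the top nonzero multiple of `y` is a multiple of `p ^ n
x`; subtracting a multiple of `x` from `y` lowers its order. Hence cyclic submodules of `E[J]` form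
a chain. -/
theorem mem_span_singleton_of_pow_smul_eq_zero {p : R} (hp : maximalIdeal R = Ideal.span {p})
    {E : Type u} [AddCommGroup E] [Module R E] (i : (R ⧸ maximalIdeal R) →ₗ[R] E)
    (hi : IsInjectiveHull i) {n : ℕ} {x : E} (hx0 : p ^ n • x ≠ 0) (hx : p ^ (n + 1) • x = 0)
    {m : ℕ} (hmn : m ≤ n + 1) {y : E} (hy : p ^ m • y = 0) : y ∈ Submodule.span R {x} := by
  induction m generalizing y with
  | zero =>
    obtain rfl : y = 0 := by simpa using hy
    exact zero_mem _
  | succ m ih =>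
    obtain ⟨c, hc⟩ := Submodule.mem_span_singleton.1
      (mem_span_singleton_of_mem_torsionBySet i hi hx0 (smul_eq_zero_of_mem_maximalIdeal hp hy)
        (smul_eq_zero_of_mem_maximalIdeal hp hx))
    have h1 : c • p ^ n • x = p ^ m • (c * p ^ (n - m)) • x := by
      rw [smul_smul, smul_smul, mul_left_comm, ← pow_add, Nat.add_sub_cancel' (by omega)]
    have h2 := ih (by omega) (y := y - (c * p ^ (n - m)) • x) (by
      rw [smul_sub, ← h1, hc, sub_self])
    have h3 := add_mem h2
      (Submodule.smul_mem _ (c * p ^ (n - m)) (Submodule.mem_span_singleton_self x))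
    rwa [sub_add_cancel] at h3

theorem exists_pow_smul_of_mem_torsionBySet {p : R} (hp : maximalIdeal R = Ideal.span {p})
    {E : Type u} [AddCommGroup E] [Module R E] (i : (R ⧸ maximalIdeal R) →ₗ[R] E)
    (hi : IsInjectiveHull i) {x : E} (hx0 : x ≠ 0)
    (hx : x ∈ Submodule.torsionBySet R E (⨅ n : ℕ, maximalIdeal R ^ n : Ideal R)) :
    ∃ n : ℕ, p ^ n • x ≠ 0 ∧ p ^ (n + 1) • x = 0 := by
  have h1 : Submodule.span R {x} ⊓ LinearMap.range i ≠ ⊥ := fun h =>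
    hx0 (by simpa using hi.2.2 _ h)
  obtain ⟨y, ⟨hy, hyi⟩, hy0⟩ := Submodule.exists_mem_ne_zero_of_ne_bot h1
  obtain ⟨r, rfl⟩ := Submodule.mem_span_singleton.1 hy
  rw [range_eq_torsionBySet_maximalIdeal i hi] at hyi
  have hr : r ∉ ⨅ n : ℕ, maximalIdeal R ^ n := fun hr =>
    hy0 ((Submodule.mem_torsionBySet_iff _ _).1 hx ⟨r, hr⟩)
  obtain ⟨n, u, rfl⟩ := eq_pow_mul_of_notMem_iInf hp hr
  refine ⟨n, fun h => hy0 (by rw [mul_comm, mul_smul, h, smul_zero]), ?_⟩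
  have h2 := (Submodule.mem_torsionBySet_iff _ _).1 hyi ⟨p, hp ▸ Ideal.mem_span_singleton_self p⟩
  change p • (p ^ n * (u : R)) • x = 0 at h2
  rw [smul_smul, show p * (p ^ n * (u : R)) = u * p ^ (n + 1) by ring, mul_smul] at h2
  exact (u.isUnit.smul_eq_zero).1 h2

/-- A strictly descending chain leaves the top submodule after one step. -/
theorem isArtinian_of_forall_ne_top {S X : Type u} [Ring S] [AddCommGroup X] [Module S X]
    (h : ∀ K : Submodule S X, K ≠ ⊤ → IsArtinian S K) : IsArtinian S X := by
  have hacc : ∀ K : Submodule S X, K ≠ ⊤ → Acc (· < ·) K := by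
    intro K hK
    have := h K hK
    have key : ∀ I : Submodule S K, Acc (· < ·) (I.map K.subtype) := by
      intro I
      induction I using WellFoundedLT.induction with
      | ind I ih =>
        refine Acc.intro _ fun L hL => ?_
        have hLK : L ≤ K := hL.le.trans (Submodule.map_subtype_le K I)
        have hL' : (L.comap K.subtype).map K.subtype = L := by
          rw [Submodule.map_comap_subtype, inf_eq_right.2 hLK]
        rw [← hL'] at hL ⊢
        exact ih _ ((Submodule.map_lt_map_iff_of_injective K.injective_subtype).1 hL)
    simpa using key ⊤
  refine ⟨⟨fun K => ?_⟩⟩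
  exact Acc.intro K fun L hL => hacc L (ne_top_of_lt hL)

theorem isArtinian_torsionBySet_iInf_pow
    (h : ∀ a ∈ maximalIdeal R, ∀ b ∈ maximalIdeal R, ∃ c ∈ maximalIdeal R, c ∣ a ∧ c ∣ b)
    {E : Type u} [AddCommGroup E] [Module R E] (i : (R ⧸ maximalIdeal R) →ₗ[R] E)
    (hi : IsInjectiveHull i) :
    IsArtinian R (Submodule.torsionBySet R E (⨅ n : ℕ, maximalIdeal R ^ n : Ideal R)) := by
  rcases maximalIdeal_eq_span_or_iInf_pow_eq h with ⟨p, hp⟩ | h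
  · refine isArtinian_of_forall_ne_top fun K hK => ?_
    obtain ⟨x, -, hx⟩ := SetLike.exists_of_lt (lt_top_iff_ne_top.2 hK)
    have hx0 : (x : E) ≠ 0 := fun h0 => hx (by
      obtain rfl : x = 0 := Subtype.ext h0
      exact zero_mem K)
    obtain ⟨n, hn0, hn⟩ := exists_pow_smul_of_mem_torsionBySet hp i hi hx0 x.2
    -- An element of `K` of order larger than that of `x` would generate `x ∉ K`, so `K` lies in `R
    -- x`, which has finite length.
    have hle : K ≤ Submodule.span R {x} := by
      intro y hy
      by_cases hy0 : (y : E) = 0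
      · obtain rfl : y = 0 := Subtype.ext hy0
        exact zero_mem _
      obtain ⟨m, hm0, hm⟩ := exists_pow_smul_of_mem_torsionBySet hp i hi hy0 y.2
      rcases le_total m n with hmn | hmn
      · obtain ⟨c, hc⟩ := Submodule.mem_span_singleton.1
          (mem_span_singleton_of_pow_smul_eq_zero hp i hi hn0 hn (by omega) hm)
        exact Submodule.mem_span_singleton.2 ⟨c, Subtype.ext hc⟩
      · obtain ⟨c, hc⟩ := Submodule.mem_span_singleton.1
          (mem_span_singleton_of_pow_smul_eq_zero hp i hi hm0 hm
            (Nat.succ_le_succ hmn) hn)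
        refine absurd ?_ hx
        have : c • y = x := Subtype.ext hc
        exact this ▸ K.smul_mem c hy
    have := (isFiniteLength_iff_isNoetherian_isArtinian.1
      (isFiniteLength_span_singleton hp (n + 1) x (Subtype.ext hn))).2
    exact isArtinian_of_injective (Submodule.inclusion hle) (Submodule.inclusion_injective hle)
  · rw [h, ← range_eq_torsionBySet_maximalIdeal i hi]
    have := (isFiniteLength_iff_isNoetherian_isArtinian.1 (isFiniteLength_residue (R := R))).2
    exact isArtinian_of_surjective _ i.rangeRestrict i.surjective_rangeRestrict

/-- `L(P)` is the annihilator of `J` in the injective hull of the residue field. -/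
theorem sumFiniteLength_eq_torsionBySet
    (h : ∀ a ∈ maximalIdeal R, ∀ b ∈ maximalIdeal R, ∃ c ∈ maximalIdeal R, c ∣ a ∧ c ∣ b) :
    sumFiniteLength R (maximalIdeal R) = Submodule.torsionBySet R
      (injectiveHull R (R ⧸ maximalIdeal R)) (⨅ n : ℕ, maximalIdeal R ^ n : Ideal R) := by
  have hi := injectiveHull.isInjectiveHull R (R ⧸ maximalIdeal R)
  apply le_antisymm
  · refine sSup_le fun N hN x hx => ?_
    have := (isFiniteLength_iff_isNoetherian_isArtinian.1 hN).2
    rw [Submodule.mem_torsionBySet_iff]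
    intro a
    exact congrArg Subtype.val
      (@isTorsionBySet_iInf_pow_of_isArtinian R _ _ N _ _ _ ⟨x, hx⟩ a)
  · rcases maximalIdeal_eq_span_or_iInf_pow_eq h with ⟨p, hp⟩ | h
    · intro x hx
      by_cases hx0 : x = 0
      · exact hx0 ▸ zero_mem _
      obtain ⟨n, -, hn⟩ := exists_pow_smul_of_mem_torsionBySet hp _ hi hx0 hx
      exact le_sSup (a := Submodule.span R {x}) (isFiniteLength_span_singleton hp _ x hn)
        (Submodule.mem_span_singleton_self x)
    · rw [h, ← range_eq_torsionBySet_maximalIdeal _ hi]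
      refine le_sSup ?_
      exact (LinearEquiv.ofInjective _ hi.2.1).isFiniteLength isFiniteLength_residue

theorem isRDInjective_sumFiniteLength_iff (hP : IsRDFlat R (R ⧸ maximalIdeal R)) :
    IsRDInjective R (sumFiniteLength R (maximalIdeal R)) ↔
      IsRDFlat R (R ⧸ ⨅ n : ℕ, maximalIdeal R ^ n) := by
  have hi := injectiveHull.isInjectiveHull R (R ⧸ maximalIdeal R)
  rw [sumFiniteLength_eq_torsionBySet
    ((isRDFlat_quotient_iff_directed (Ideal.IsPrime.ne_top inferInstance)).1 hP)]
  exact ⟨isRDFlat_quotient_of_isRDInjective_torsionBySet _ hi,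
    fun h => isRDInjective_torsionBySet_of_injective h hi.1⟩

end LocalRing

theorem theoremT (R : Type u) [CommRing R] [IsLocalRing R] (P J : Ideal R)
    (hP : P = IsLocalRing.maximalIdeal R) (hJ : J = ⨅ n : ℕ, P ^ n) :
    List.TFAE [
      ∀ (M : Type u) [AddCommGroup M] [Module R M], IsArtinian R M → IsRDInjective R M,
      IsRDFlat R (R ⧸ P) ∧ IsRDFlat R (R ⧸ J),
      IsRDInjective R (R ⧸ P) ∧ IsRDInjective R (sumFiniteLength R P),
      IsDirectedFamily (nonzeroPrincipalIdealsIn P) ∧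
        IsDirectedFamily (nonzeroPrincipalIdealsIn J)] := by
  subst hJ hP
  have hPtop : IsLocalRing.maximalIdeal R ≠ ⊤ := Ideal.IsPrime.ne_top inferInstance
  have hJtop : (⨅ n : ℕ, IsLocalRing.maximalIdeal R ^ n) ≠ ⊤ := fun h =>
    hPtop (top_le_iff.1 (h ▸ (iInf_le _ 1).trans (pow_one _).le))
  tfae_have 2 ↔ 4 := by
    rw [isDirectedFamily_nonzeroPrincipalIdealsIn_iff,
      isDirectedFamily_nonzeroPrincipalIdealsIn_iff, isRDFlat_quotient_iff_directed hPtop,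
      isRDFlat_quotient_iff_directed hJtop]
  tfae_have 2 ↔ 3 := by
    rw [isRDInjective_residue_iff]
    exact and_congr_right fun h => (isRDInjective_sumFiniteLength_iff h).symm
  tfae_have 2 → 1 := fun h M _ _ _ => isRDInjective_of_isArtinian h.1 h.2
  tfae_have 1 → 3 := by
    intro h
    have hres : IsRDInjective R (R ⧸ IsLocalRing.maximalIdeal R) :=
      h _ (isFiniteLength_iff_isNoetherian_isArtinian.1 isFiniteLength_residue).2
    -- Directedness of `P*`, extracted from `R/P` alone, is what identifies `L(P)` with the artinian
    -- module `E[J]`.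
    have hdir := (isRDFlat_quotient_iff_directed hPtop).1 (isRDInjective_residue_iff.1 hres)
    refine ⟨hres, h _ ?_⟩
    rw [sumFiniteLength_eq_torsionBySet hdir]
    exact isArtinian_torsionBySet_iInf_pow hdir _ (injectiveHull.isInjectiveHull R _)
  tfae_finish
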